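/- For $k \in \mathbb{Z}$ let $W_k$ denote the standard $k$-th branch of the Lambert $W$ function: $w = W_k(z)$ is the solution of $w e^w = z$ in the range of the $k$-th branch. The ranges partition the $w$-plane along the half-line $(-\infty,-1]$ and the curves $\{-\eta\cot\eta + \eta i\}$ with $-\pi < \eta < \pi$, and with $2j\pi < \pm\eta < (2j+1)\pi$ for $j \ge 1$; the range of $W_0$ is the region containing $0$, and the ranges of $W_1, W_2, \dots$ (respectively $W_{-1}, W_{-2}, \dots$) follow in order above (respectively below) it. Each range contains its upper boundary and not its lower one (so that $W_k$ is continuous from the upper half-plane on its branch cuts), except that $-1$ belongs to the ranges of both $W_0$ and $W_{-1}$. Let $\log$ be the principal logarithm, with $\operatorname{Im}\log \in (-\pi,\pi]$. **Theorem.** Let $k \in \mathbb{Z}$ and $z \in \mathbb{C}\setminus\{0\}$, with $|z| > 1$ if $k = 0$. Put $$L_1 = \log(z) + 2\pi k i, \quad L_2 = \log(L_1), \quad \sigma = 1/L_1, \quad \tau = L_2/L_1,$$ $$c_{l,m} = \frac{(-1)^l}{m!}\left[{l+m \atop l+1}\right],$$ where $\left[{n \atop j}\right]$ is the unsigned Stirling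 number of the first kind. If $|\sigma| < 1/4$ and $|\tau| < 1/4$, then for all integers $L, M \ge 0$ $$W_k(z) = L_1 - L_2 + \sum_{l=0}^{L-1}\sum_{m=1}^{M-1} c_{l,m}\,\sigma^l\tau^m + \varepsilon_{L,M}(z)$$ with $$|\varepsilon_{L,M}(z)| \le \frac{4|\tau|(4|\sigma|)^L + (4|\tau|)^M}{(1-4|\sigma|)(1-4|\tau|)}.$$ -/

import Mathlib

noncomputable section

namespace LambertW

/-- `x sinc y + cos y` for `w = x + iy`. For `y` not a nonzero multiple of `π`, it vanishes exactly
when `w` lies on one of the curves `-η cot η + iη` (with the point `-1` at `η = 0`). -/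
def curveFun (w : ℂ) : ℝ := w.re * Real.sinc w.im + Real.cos w.im

/-- The range of the standard `k`-th branch `W_k` of the Lambert function. The ranges are separated
by the half-line `(-∞, -1]` and the curves `-η cot η + iη` with `-π < η < π`, and with
`2jπ < ±η < (2j+1)π` for `j ≥ 1`. Every range contains its upper boundary and not its lower one, so
that `W_k` is continuous from the upper half-plane on its branch cuts; the point `-1` belongs to the
ranges of both `W_0` and `W_{-1}`. In each case below, the strips where a condition on `curveFun`
is imposed are those in which a boundary curve runs, and there `curveFun w > 0` means that `w` is
to the right of the curve and `curveFun w < 0` that it is to the left. -/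
def branchRange (k : ℤ) : Set ℂ :=
  if k = 0 then
    {w | |w.im| < Real.pi ∧ (0 < curveFun w ∨ (curveFun w = 0 ∧ 0 ≤ w.im))}
  else if 0 < k then
    {w | (2 * (k : ℝ) - 2) * Real.pi < w.im ∧ w.im < (2 * (k : ℝ) + 1) * Real.pi ∧
      (w.im ≤ (2 * (k : ℝ) - 1) * Real.pi → curveFun w < 0) ∧
      (2 * (k : ℝ) * Real.pi ≤ w.im → 0 ≤ curveFun w)}
  else
    {w | (2 * (k : ℝ) - 1) * Real.pi < w.im ∧ w.im ≤ (2 * (k : ℝ) + 2) * Real.pi ∧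
      ((2 * (k : ℝ) + 1) * Real.pi ≤ w.im → curveFun w ≤ 0) ∧
      (w.im ≤ 2 * (k : ℝ) * Real.pi → 0 < curveFun w)}

open Classical in
/-- The standard branch `W_k(z)` of the Lambert function: the solution `w` of `w e^w = z` in the
range of the `k`-th branch. (There is none only if `z = 0` and `k ≠ 0`, where `W_k` is singular; the
value is then set to `0`.) -/
def W (k : ℤ) (z : ℂ) : ℂ :=
  if h : ∃ w : ℂ, w ∈ branchRange k ∧ w * Complex.exp w = z then h.choose else 0

/-- `L₁ = log z + 2πki`. -/
def L₁ (k : ℤ) (z : ℂ) : ℂ := Complex.log z + 2 * (Real.pi : ℂ) * (k : ℂ) * Complex.I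

/-- `L₂ = log L₁`. -/
def L₂ (k : ℤ) (z : ℂ) : ℂ := Complex.log (L₁ k z)

/-- `σ = 1 / L₁`. -/
def sigma (k : ℤ) (z : ℂ) : ℂ := 1 / L₁ k z

/-- `τ = L₂ / L₁`. -/
def tau (k : ℤ) (z : ℂ) : ℂ := L₂ k z / L₁ k z

/-- `c_{l,m} = ((-1)^l / m!) [l+m, l+1]`, with the unsigned Stirling numbers of the first kind. -/
def c (l m : ℕ) : ℝ := (-1) ^ l / (m.factorial : ℝ) * (Nat.stirlingFirst (l + m) (l + 1) : ℝ)

end LambertW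

end

namespace LambertW

/-! With `v` the sum of the double series in `σ`, `τ`, the claim is that `W_k(z) = L₁ - L₂ + v`; the
error bound is then a geometric tail, since `|c_{l,m}| ≤ 4^(l+m)` (`norm_c_le`).

The Stirling recurrence makes `v` a solution of `(1 + σ - τ) v_τ - σ v_σ = 1` with `v = 0` at `τ =
0`. Along its characteristics `v` is the parameter, which gives `e^{-v} = 1 - τ + σ v` for small `τ`
and then, by the identity theorem, on the whole disc (`exp_neg_series`). Multiplied by `L₁`, this
says that `u = L₂ - v` satisfies `e^u + u = L₁`, so that `w = e^u` solves `w e^w = z`.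

It remains to identify the branch. Up to boundary points, the range of `W_k` consists of the `w =
e^u` with `|Im u| ≤ π` and `Im (w + u)` in the `k`-th period strip. As `u ↦ u + e^u` is injective
there (`eq_of_exp_add_eq`), each range holds at most one solution. The bound `|v| < 1`
(`norm_series_lt_one`) keeps `u` close enough to `L₂` for `e^u` to lie in the right range
(`exp_L₂_sub_mem_branchRange`). -/

/-! ### Bounds and recurrences for the coefficients. -/

/-- An ordered list of `k + 1` cycles, each written from its least element, is an arrangement of `n
+ 1` points cut into `k + 1` blocks, and there are `n.choose k` ways to cut. The induction sets the
Stirling recurrence against Pascal's rule. -/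
theorem stirlingFirst_mul_factorial_le (n k : ℕ) :
    Nat.stirlingFirst (n + 1) (k + 1) * (k + 1).factorial ≤ n.choose k * (n + 1).factorial := by
  induction n generalizing k with
  | zero =>
    cases k with
    | zero => simp [Nat.stirlingFirst]
    | succ k => simp [Nat.stirlingFirst]
  | succ n ih =>
    rw [Nat.stirlingFirst_succ_succ]
    rcases Nat.lt_or_ge (n + 1) k with h | h
    · rw [Nat.stirlingFirst_eq_zero_of_lt (by omega), Nat.stirlingFirst_eq_zero_of_lt (by omega)]
      simp
    · cases k with
      | zero =>
        have h0 := ih 0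
        simp only [Nat.choose_zero_right, zero_add, Nat.factorial_one, mul_one, one_mul,
          Nat.stirlingFirst_succ_zero, add_zero] at h0 ⊢
        rw [Nat.factorial_succ (n + 1)]
        nlinarith
      | succ k =>
        have h1 := ih (k + 1)
        have h2 := ih k
        rw [Nat.choose_succ_succ, Nat.factorial_succ (n + 1)]
        have h3 : n.choose k * (n + 1).factorial * (k + 2)
            ≤ n.choose k * (n + 1).factorial * (n + 2) := Nat.mul_le_mul_left _ (by omega)
        have h4 : n.choose (k + 1) * (n + 1).factorial * (n + 1)
            ≤ n.choose (k + 1) * (n + 1).factorial * (n + 2) := Nat.mul_le_mul_left _ (by omega)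
        have h5 : (k + 1 + 1).factorial = (k + 2) * (k + 1).factorial := Nat.factorial_succ _
        calc _ = (Nat.stirlingFirst (n + 1) (k + 1 + 1) * (k + 1 + 1).factorial) * (n + 1)
              + (Nat.stirlingFirst (n + 1) (k + 1) * (k + 1).factorial) * (k + 2) := by
                rw [h5]; ring
          _ ≤ (n.choose (k + 1) * (n + 1).factorial) * (n + 1)
              + (n.choose k * (n + 1).factorial) * (k + 2) := by gcongr
          _ ≤ _ := by linarith

/-- Two binomial coefficients occur, each at most a power of `2`; their product is the source of the
`4`. -/
theorem stirlingFirst_le_factorial_mul (l m : ℕ) :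
    Nat.stirlingFirst (l + m) (l + 1) ≤ m.factorial * 4 ^ (l + m) := by
  cases m with
  | zero => simp [Nat.stirlingFirst_eq_zero_of_lt (Nat.lt_succ_self l)]
  | succ m =>
    have h := stirlingFirst_mul_factorial_le (l + m) l
    have h1 : (l + m + 1).factorial = (l + m + 1).choose l * l.factorial * (m + 1).factorial := by
      have := Nat.choose_mul_factorial_mul_factorial (show l ≤ l + m + 1 by omega)
      rw [show l + m + 1 - l = m + 1 by omega] at this
      exact this.symm
    have h2 : (l + m).choose l ≤ 2 ^ (l + m + 1) :=
      (Nat.choose_le_two_pow _ _).trans (Nat.pow_le_pow_right (by norm_num) (by omega))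
    have h3 : (l + m + 1).choose l ≤ 2 ^ (l + m + 1) := Nat.choose_le_two_pow _ _
    have h4 : l.factorial ≤ (l + 1).factorial := Nat.factorial_le (by omega)
    refine Nat.le_of_mul_le_mul_right ?_ (Nat.factorial_pos (l + 1))
    calc Nat.stirlingFirst (l + (m + 1)) (l + 1) * (l + 1).factorial
        ≤ (l + m).choose l * ((l + m + 1).choose l * l.factorial * (m + 1).factorial) := by
          rw [← h1]; exact h
      _ ≤ 2 ^ (l + m + 1) * (2 ^ (l + m + 1) * (l + 1).factorial * (m + 1).factorial) := by gcongr
      _ = (m + 1).factorial * 4 ^ (l + (m + 1)) * (l + 1).factorial := by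
          rw [show 4 = 2 * 2 from rfl, mul_pow, ← add_assoc]; ring

theorem norm_c_le (l m : ℕ) : ‖(c l m : ℂ)‖ ≤ 4 ^ (l + m) := by
  rw [Complex.norm_real, c, norm_mul, norm_div, norm_pow, norm_neg, norm_one, one_pow,
    Real.norm_natCast, Real.norm_natCast, one_div, inv_mul_le_iff₀ (by positivity)]
  exact_mod_cast stirlingFirst_le_factorial_mul l m

theorem c_zero_right (l : ℕ) : c l 0 = 0 := by
  simp [c, Nat.stirlingFirst_eq_zero_of_lt (Nat.lt_succ_self l)]

/-- This and `c_succ_recurrence` are the differential equation of the series read off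
coefficientwise; the `if` is its constant term. -/
theorem c_zero_recurrence (m : ℕ) :
    ((m : ℝ) + 1) * c 0 (m + 1) = (m : ℝ) * c 0 m + if m = 0 then 1 else 0 := by
  have hm : ((m.factorial : ℕ) : ℝ) ≠ 0 := by positivity
  have h := Nat.stirlingFirst_succ_succ m 0
  have h1 : Nat.stirlingFirst m 0 = if m = 0 then 1 else 0 := by
    cases m <;> simp
  rw [h1] at h
  simp only [c, zero_add, pow_zero, Nat.factorial_succ]
  rw [show Nat.stirlingFirst (m + 1) 1 = _ from h]
  push_cast
  split_ifs with h0
  · subst h0; simp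
  · field_simp; simp

theorem c_succ_recurrence (l m : ℕ) :
    ((m : ℝ) + 1) * c (l + 1) (m + 1)
      = ((l : ℝ) + 1 + m) * c (l + 1) m - ((m : ℝ) + 1) * c l (m + 1) := by
  have hm : ((m.factorial : ℕ) : ℝ) ≠ 0 := by positivity
  have h := Nat.stirlingFirst_succ_succ (l + 1 + m) (l + 1)
  simp only [c, Nat.factorial_succ, pow_succ]
  rw [show l + 1 + (m + 1) = l + 1 + m + 1 by ring, show l + (m + 1) = l + 1 + m by ring, h]
  push_cast
  field_simp
  ring

/-! ### The double series and its truncation. -/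

/-- The term of index `(l, m)` of the double series `∑ c_{l,m} σ^l τ^m`. -/
noncomputable def seriesTerm (σ τ : ℂ) (p : ℕ × ℕ) : ℂ := (c p.1 p.2 : ℂ) * σ ^ p.1 * τ ^ p.2

/-- The double series `∑ c_{l,m} σ^l τ^m`. -/
noncomputable def series (σ τ : ℂ) : ℂ := ∑' p, seriesTerm σ τ p

theorem norm_seriesTerm_le {σ τ : ℂ} {a b : ℝ} (hσ : ‖σ‖ ≤ a) (hτ : ‖τ‖ ≤ b) (p : ℕ × ℕ) :
    ‖seriesTerm σ τ p‖ ≤ (4 * a) ^ p.1 * (4 * b) ^ p.2 := by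
  have ha : 0 ≤ a := (norm_nonneg _).trans hσ
  rw [seriesTerm, norm_mul, norm_mul, norm_pow, norm_pow]
  calc _ ≤ 4 ^ (p.1 + p.2) * a ^ p.1 * b ^ p.2 := by gcongr; exact norm_c_le _ _
    _ = _ := by rw [mul_pow, mul_pow, pow_add]; ring

theorem summable_geometric_mul {a b : ℝ} (ha : 0 ≤ a) (ha' : a < 1 / 4) (hb : 0 ≤ b)
    (hb' : b < 1 / 4) : Summable fun p : ℕ × ℕ => (4 * a) ^ p.1 * (4 * b) ^ p.2 :=
  (summable_geometric_of_lt_one (r := 4 * a) (by positivity) (by linarith)).mul_of_nonneg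
    (summable_geometric_of_lt_one (r := 4 * b) (by positivity) (by linarith))
    (fun _ => by positivity) (fun _ => by positivity)

theorem summable_norm_seriesTerm {σ τ : ℂ} (hσ : ‖σ‖ < 1 / 4) (hτ : ‖τ‖ < 1 / 4) :
    Summable fun p => ‖seriesTerm σ τ p‖ :=
  (summable_geometric_mul (norm_nonneg σ) hσ (norm_nonneg τ) hτ).of_nonneg_of_le
    (fun _ => norm_nonneg _) (norm_seriesTerm_le le_rfl le_rfl)

theorem hasSum_series {σ τ : ℂ} (hσ : ‖σ‖ < 1 / 4) (hτ : ‖τ‖ < 1 / 4) :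
    HasSum (seriesTerm σ τ) (series σ τ) :=
  (summable_norm_seriesTerm hσ hτ).of_norm.hasSum

theorem hasSum_indicator_geometric {r : ℝ} (h0 : 0 ≤ r) (h1 : r < 1) (N : ℕ) :
    HasSum (fun n => if N ≤ n then r ^ n else 0) (r ^ N / (1 - r)) := by
  rw [← hasSum_nat_add_iff' N]
  have h : ∑ i ∈ Finset.range N, (if N ≤ i then r ^ i else 0) = 0 :=
    Finset.sum_eq_zero fun i hi => if_neg (by simpa using hi)
  rw [h, sub_zero]
  simpa [pow_add, mul_comm, div_eq_mul_inv] using (hasSum_geometric_of_lt_one h0 h1).mul_left (r ^ N)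

/-- The truncation error of the double series. -/
theorem norm_series_sub_sum_le {σ τ : ℂ} (hσ : ‖σ‖ < 1 / 4) (hτ : ‖τ‖ < 1 / 4) (L M : ℕ) :
    ‖series σ τ - ∑ l ∈ Finset.range L, ∑ m ∈ Finset.Ico 1 M, (c l m : ℂ) * σ ^ l * τ ^ m‖
      ≤ (4 * ‖τ‖ * (4 * ‖σ‖) ^ L + (4 * ‖τ‖) ^ M) / ((1 - 4 * ‖σ‖) * (1 - 4 * ‖τ‖)) := by
  set q := 4 * ‖σ‖ with hq
  set r := 4 * ‖τ‖ with hr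
  have q0 : 0 ≤ q := by positivity
  have r0 : 0 ≤ r := by positivity
  have q1 : q < 1 := by linarith
  have r1 : r < 1 := by linarith
  have hmul {f g : ℕ → ℝ} {x y : ℝ} (hf : HasSum f x) (hg : HasSum g y) (hf0 : ∀ n, 0 ≤ f n)
      (hg0 : ∀ n, 0 ≤ g n) : HasSum (fun p : ℕ × ℕ => f p.1 * g p.2) (x * y) :=
    hf.mul hg (hf.summable.mul_of_nonneg hg.summable hf0 hg0)
  have ind0 (x : ℝ) (hx : 0 ≤ x) (N n : ℕ) : 0 ≤ if N ≤ n then x ^ n else 0 := by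
    split_ifs <;> positivity
  -- Outside the rectangle a nonzero term has `l ≥ L` and `m ≥ 1`, or else `m ≥ M`. The lower index
  -- `1`, due to `c_{l,0} = 0`, yields the factor `4|τ|` in the first part of the bound.
  have hB := (hmul (hasSum_indicator_geometric q0 q1 L) (hasSum_indicator_geometric r0 r1 1)
    (ind0 q q0 L) (ind0 r r0 1)).add
    (hmul (hasSum_indicator_geometric q0 q1 0) (hasSum_indicator_geometric r0 r1 M)
    (ind0 q q0 0) (ind0 r r0 M))
  set s : Finset (ℕ × ℕ) := Finset.range L ×ˢ Finset.Ico 1 M with hs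
  have hsum : ∑ l ∈ Finset.range L, ∑ m ∈ Finset.Ico 1 M, (c l m : ℂ) * σ ^ l * τ ^ m
      = ∑ p ∈ s, seriesTerm σ τ p := by
    rw [hs, Finset.sum_product]; rfl
  have hE : HasSum (fun p => seriesTerm σ τ p - if p ∈ s then seriesTerm σ τ p else 0)
      (series σ τ - ∑ p ∈ s, seriesTerm σ τ p) := by
    refine (hasSum_series hσ hτ).sub ?_
    rw [← Finset.sum_congr rfl fun p hp => if_pos (c := p ∈ s) (t := seriesTerm σ τ p) (e := 0) hp]
    exact hasSum_sum_of_ne_finset_zero fun p hp => if_neg hp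
  rw [hsum, ← hE.tsum_eq]
  refine (tsum_of_norm_bounded hB fun p => ?_).trans (le_of_eq ?_)
  · have hqr : 0 ≤ q ^ p.1 * r ^ p.2 := by positivity
    have hterm : ‖seriesTerm σ τ p‖ ≤ q ^ p.1 * r ^ p.2 := norm_seriesTerm_le le_rfl le_rfl p
    by_cases hp : p ∈ s
    · rw [if_pos hp, sub_self, norm_zero]
      exact add_nonneg (mul_nonneg (ind0 q q0 _ _) (ind0 r r0 _ _))
        (mul_nonneg (ind0 q q0 _ _) (ind0 r r0 _ _))
    rw [if_neg hp, sub_zero]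
    have hp' : p.1 < L → 1 ≤ p.2 → M ≤ p.2 := by
      simpa [hs] using hp
    by_cases h1 : 1 ≤ p.2
    · by_cases hL : L ≤ p.1
      · by_cases hM : M ≤ p.2 <;> simp [h1, hL, hM] <;> linarith
      · simp [hL, hp' (by omega) h1, hterm]
    · have : p.2 = 0 := by omega
      rw [seriesTerm, this, c_zero_right]
      simp only [Complex.ofReal_zero, zero_mul, norm_zero]
      have := ind0 r r0 M 0
      simp only [nonpos_iff_eq_zero, one_ne_zero, if_false, mul_zero, zero_add, zero_le, if_true]
      positivity
  · have : 1 - q ≠ 0 := by linarith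
    have : 1 - r ≠ 0 := by linarith
    field_simp

/-! ### The differential equation of the series and the functional equation it implies. -/

section Series

open Filter Topology

theorem differentiableOn_series_comp {U : Set ℂ} (hU : IsOpen U) {f g : ℂ → ℂ} {a : ℝ}
    (ha0 : 0 ≤ a) (ha : a < 1 / 4) (hf : DifferentiableOn ℂ f U) (hg : DifferentiableOn ℂ g U)
    (hfa : ∀ x ∈ U, ‖f x‖ ≤ a) (hga : ∀ x ∈ U, ‖g x‖ ≤ a) :
    DifferentiableOn ℂ (fun x => series (f x) (g x)) U :=
  Complex.differentiableOn_tsum_of_summable_norm (summable_geometric_mul ha0 ha ha0 ha)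
    (fun p => ((hf.pow p.1).const_mul (c p.1 p.2 : ℂ)).mul (hg.pow p.2)) hU
    (fun p x hx => norm_seriesTerm_le (hfa x hx) (hga x hx) p)

theorem hasSum_deriv_series_comp {U : Set ℂ} (hU : IsOpen U) {f g : ℂ → ℂ} {a : ℝ}
    (ha0 : 0 ≤ a) (ha : a < 1 / 4) (hf : DifferentiableOn ℂ f U) (hg : DifferentiableOn ℂ g U)
    (hfa : ∀ x ∈ U, ‖f x‖ ≤ a) (hga : ∀ x ∈ U, ‖g x‖ ≤ a) {x f' g' : ℂ} (hx : x ∈ U)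
    (hf' : HasDerivAt f f' x) (hg' : HasDerivAt g g' x) :
    HasSum (fun p : ℕ × ℕ => (c p.1 p.2 : ℂ) * (p.1 * f x ^ (p.1 - 1) * f') * g x ^ p.2
        + (c p.1 p.2 : ℂ) * f x ^ p.1 * (p.2 * g x ^ (p.2 - 1) * g'))
      (deriv (fun x => series (f x) (g x)) x) := by
  have h := Complex.hasSum_deriv_of_summable_norm (summable_geometric_mul ha0 ha ha0 ha)
    (fun p => ((hf.pow p.1).const_mul (c p.1 p.2 : ℂ)).mul (hg.pow p.2)) hU
    (fun p x hx => norm_seriesTerm_le (hfa x hx) (hga x hx) p) hx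
  refine h.congr_fun fun p => ?_
  exact ((((hf'.fun_pow p.1).const_mul (c p.1 p.2 : ℂ)).mul (hg'.fun_pow p.2)).deriv).symm

/-- `A` is `σ v_σ + τ v_τ`, the derivative of `x ↦ v(σx, τx)` at `x = 1`. -/
theorem exists_hasSum_euler {σ τ : ℂ} (hσ : ‖σ‖ < 1 / 4) (hτ : ‖τ‖ < 1 / 4) :
    ∃ A, HasSum (fun p : ℕ × ℕ => ((p.1 : ℂ) + p.2) * c p.1 p.2 * σ ^ p.1 * τ ^ p.2) A := by
  obtain ⟨a, ha, ha'⟩ := exists_between (max_lt hσ hτ)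
  have hσa := (le_max_left _ _).trans_lt ha
  have hτa := (le_max_right _ _).trans_lt ha
  have hc (z : ℂ) : Continuous fun x : ℂ => ‖z * x‖ := by fun_prop
  have h := hasSum_deriv_series_comp (U := {x | ‖σ * x‖ < a ∧ ‖τ * x‖ < a}) (x := 1)
    ((isOpen_lt (hc σ) continuous_const).inter (isOpen_lt (hc τ) continuous_const))
    ((norm_nonneg σ).trans hσa.le) ha' (f := fun x => σ * x) (g := fun x => τ * x) (by fun_prop)
    (by fun_prop) (fun x hx => hx.1.le) (fun x hx => hx.2.le) (by simp [hσa, hτa])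
    ((hasDerivAt_id 1).const_mul σ) ((hasDerivAt_id 1).const_mul τ)
  refine ⟨_, h.congr_fun fun p => ?_⟩
  obtain ⟨l, m⟩ := p
  rcases l with _ | l <;> rcases m with _ | m <;> simp [pow_succ] <;> ring

theorem exists_hasSum_partial {σ τ : ℂ} (hσ : ‖σ‖ < 1 / 4) (hτ : ‖τ‖ < 1 / 4) :
    ∃ B, HasSum (fun p : ℕ × ℕ => (p.2 : ℂ) * c p.1 p.2 * σ ^ p.1 * τ ^ (p.2 - 1)) B := by
  obtain ⟨a, ha, ha'⟩ := exists_between (max_lt hσ hτ)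
  have hσa := (le_max_left _ _).trans_lt ha
  have hτa := (le_max_right _ _).trans_lt ha
  have h := hasSum_deriv_series_comp (U := {x | ‖x‖ < a}) (x := τ)
    (isOpen_lt continuous_norm continuous_const)
    ((norm_nonneg σ).trans hσa.le) ha' (f := fun _ => σ) (g := fun x => x) (by fun_prop)
    (by fun_prop) (fun x hx => hσa.le) (fun x hx => le_of_lt hx) hτa
    (hasDerivAt_const τ σ) (hasDerivAt_id τ)
  refine ⟨_, h.congr_fun fun p => ?_⟩
  simp
  ring

/-- The linear differential equation of the series, in terms of the sums of its derivatives. -/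
theorem series_linear_pde {σ τ A B : ℂ}
    (hA : HasSum (fun p : ℕ × ℕ => ((p.1 : ℂ) + p.2) * c p.1 p.2 * σ ^ p.1 * τ ^ p.2) A)
    (hB : HasSum (fun p : ℕ × ℕ => (p.2 : ℂ) * c p.1 p.2 * σ ^ p.1 * τ ^ (p.2 - 1)) B) :
    (1 + σ) * B = 1 + A := by
  have hB1 : HasSum (fun p : ℕ × ℕ => ((p.2 : ℂ) + 1) * c p.1 (p.2 + 1) * σ ^ p.1 * τ ^ p.2) B := by
    have hinj : Function.Injective fun p : ℕ × ℕ => (p.1, p.2 + 1) := by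
      rintro ⟨l, m⟩ ⟨l', m'⟩ h
      simpa using h
    refine ((hinj.hasSum_iff ?_).mpr hB).congr_fun fun p => by simp
    rintro ⟨l, m⟩ h
    rcases m with _ | m
    · simp
    · exact absurd ⟨(l, m), rfl⟩ h
  have hB2 : HasSum (fun p : ℕ × ℕ => if p.1 = 0 then 0 else
      ((p.2 : ℂ) + 1) * c (p.1 - 1) (p.2 + 1) * σ ^ p.1 * τ ^ p.2) (σ * B) := by
    have hinj : Function.Injective fun p : ℕ × ℕ => (p.1 + 1, p.2) := by
      rintro ⟨l, m⟩ ⟨l', m'⟩ h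
      simpa using h
    refine (hinj.hasSum_iff ?_).mp ((hB1.mul_left σ).congr_fun fun p => ?_)
    · rintro ⟨l, m⟩ h
      rcases l with _ | l
      · simp
      · exact absurd ⟨(l, m), rfl⟩ h
    · simp [pow_succ]
      ring
  -- By the recurrences all coefficients cancel except the one at `(0, 0)`.
  have h := ((hB1.add hB2).sub hA).unique ((hasSum_ite_eq ((0, 0) : ℕ × ℕ) (1 : ℂ)).congr_fun ?_)
  · linear_combination h
  rintro ⟨l, m⟩
  rcases l with _ | l
  · have h := congrArg (fun x : ℝ => (x : ℂ)) (c_zero_recurrence m)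
    push_cast at h
    rcases m with _ | m
    · simp at h ⊢
      simp [h]
    · simp at h ⊢
      linear_combination τ ^ (m + 1) * h
  · have h := congrArg (fun x : ℝ => (x : ℂ)) (c_succ_recurrence l m)
    push_cast at h
    simp
    linear_combination σ ^ (l + 1) * τ ^ m * h

theorem series_zero_right (σ : ℂ) : series σ 0 = 0 := by
  have h (p : ℕ × ℕ) : seriesTerm σ 0 p = 0 := by
    obtain ⟨l, m⟩ := p
    rcases m with _ | m <;> simp [seriesTerm, c_zero_right]
  simp [series, h]

/-- Along a characteristic of its differential equation the series is the parameter. -/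
theorem eventually_series_characteristic {σ : ℂ} (hσ : ‖σ‖ < 1 / 4) :
    ∀ᶠ s in 𝓝 (0 : ℂ), series σ (1 - Complex.exp (-s) + σ * s) = s := by
  obtain ⟨a, ha, ha'⟩ := exists_between hσ
  have ha0 : 0 < a := (norm_nonneg σ).trans_lt ha
  have h1 : ∀ᶠ q : ℂ × ℂ in 𝓝 (0, 0), ‖σ * Complex.exp (q.1 - q.2)‖ < a ∧
      ‖1 - Complex.exp (-q.2) + σ * Complex.exp (q.1 - q.2) * q.2‖ < a := by
    refine (ContinuousAt.eventually_lt (by fun_prop) continuousAt_const (by simpa using ha)).and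
      (ContinuousAt.eventually_lt (by fun_prop) continuousAt_const (by simpa using ha0))
  obtain ⟨R, hR, hball⟩ := Metric.eventually_nhds_iff_ball.mp h1
  filter_upwards [Metric.ball_mem_nhds (0 : ℂ) hR] with s hs
  -- The characteristic solves `f' = -f`, `g' = 1 - g + f`. It leaves `τ = 0` at `x = 0` and is
  -- normalised to have `f = σ` at `x = s`.
  set f : ℂ → ℂ := fun x => σ * Complex.exp (s - x) with hf
  set g : ℂ → ℂ := fun x => 1 - Complex.exp (-x) + σ * Complex.exp (s - x) * x with hg
  have hfg (x : ℂ) (hx : x ∈ Metric.ball (0 : ℂ) R) : ‖f x‖ < a ∧ ‖g x‖ < a :=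
    hball (s, x) (by rw [← ball_prod_same]; exact ⟨hs, hx⟩)
  have hf' (x : ℂ) : HasDerivAt f (-f x) x := by
    have := (((hasDerivAt_id x).const_sub s).cexp).const_mul σ
    refine this.congr_deriv ?_
    simp [hf]
  have hg' (x : ℂ) : HasDerivAt g (1 - g x + f x) x := by
    have := (((hasDerivAt_id x).neg.cexp).const_sub 1).add ((hf' x).mul (hasDerivAt_id x))
    refine this.congr_deriv ?_
    simp [hf, hg]
    ring
  have hdf : Differentiable ℂ f := fun x => (hf' x).differentiableAt
  have hdg : Differentiable ℂ g := fun x => (hg' x).differentiableAt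
  have hder (x : ℂ) (hx : x ∈ Metric.ball (0 : ℂ) R) :
      deriv (fun x => series (f x) (g x)) x = 1 := by
    obtain ⟨A, hA⟩ := exists_hasSum_euler ((hfg x hx).1.trans ha') ((hfg x hx).2.trans ha')
    obtain ⟨B, hB⟩ := exists_hasSum_partial ((hfg x hx).1.trans ha') ((hfg x hx).2.trans ha')
    have hs := hasSum_deriv_series_comp Metric.isOpen_ball ha0.le ha' hdf.differentiableOn
      hdg.differentiableOn (fun x hx => (hfg x hx).1.le) (fun x hx => (hfg x hx).2.le) hx
      (hf' x) (hg' x)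
    rw [hs.unique (((hB.mul_left (1 + f x)).sub hA).congr_fun ?_), series_linear_pde hA hB]
    · ring
    rintro ⟨l, m⟩
    rcases l with _ | l <;> rcases m with _ | m <;> simp [pow_succ] <;> ring
  have hdiff := differentiableOn_series_comp Metric.isOpen_ball ha0.le ha' hdf.differentiableOn
      hdg.differentiableOn (fun x hx => (hfg x hx).1.le) (fun x hx => (hfg x hx).2.le)
  have hconst := Metric.isOpen_ball.is_const_of_deriv_eq_zero
    (f := fun x => series (f x) (g x) - x) (convex_ball (0 : ℂ) R).isPreconnected
    (hdiff.sub differentiableOn_id) (fun x hx => by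
      have := ((hdiff.differentiableAt (Metric.isOpen_ball.mem_nhds hx)).hasDerivAt).sub
        (hasDerivAt_id x)
      rw [hder x hx, sub_self] at this
      exact this.deriv) hs (Metric.mem_ball_self hR)
  simp only [hf, hg] at hconst
  simp [series_zero_right] at hconst
  exact sub_eq_zero.mp hconst

theorem differentiableOn_series (σ : ℂ) (hσ : ‖σ‖ < 1 / 4) :
    DifferentiableOn ℂ (series σ) (Metric.ball 0 (1 / 4)) := by
  intro τ hτ
  rw [mem_ball_zero_iff] at hτ
  obtain ⟨a, ha, ha'⟩ := exists_between (max_lt hσ hτ)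
  have hσa := (le_max_left _ _).trans_lt ha
  have hτa := (le_max_right _ _).trans_lt ha
  have h := differentiableOn_series_comp (U := Metric.ball 0 a) Metric.isOpen_ball
    ((norm_nonneg σ).trans hσa.le) ha' (f := fun _ => σ) (g := fun x => x) (by fun_prop)
    (by fun_prop) (fun x hx => hσa.le) (fun x hx => (mem_ball_zero_iff.mp hx).le)
  exact (h.differentiableAt
    (Metric.isOpen_ball.mem_nhds (mem_ball_zero_iff.mpr hτa))).differentiableWithinAt

/-- The series solves the equation `e^{-v} = 1 - τ + σ v`. -/
theorem exp_neg_series {σ τ : ℂ} (hσ : ‖σ‖ < 1 / 4) (hτ : ‖τ‖ < 1 / 4) :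
    Complex.exp (-series σ τ) = 1 - τ + σ * series σ τ := by
  have hd := differentiableOn_series σ hσ
  have h1 : AnalyticOnNhd ℂ (fun τ => Complex.exp (-series σ τ)) (Metric.ball 0 (1 / 4)) :=
    DifferentiableOn.analyticOnNhd (hd.neg.cexp) Metric.isOpen_ball
  have h2 : AnalyticOnNhd ℂ (fun τ => 1 - τ + σ * series σ τ) (Metric.ball 0 (1 / 4)) :=
    DifferentiableOn.analyticOnNhd
      (((differentiableOn_const 1).sub differentiableOn_id).add (hd.const_mul σ)) Metric.isOpen_ball
  refine h1.eqOn_of_preconnected_of_eventuallyEq h2 (convex_ball (0 : ℂ) _).isPreconnected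
    (Metric.mem_ball_self (by norm_num)) ?_ (mem_ball_zero_iff.mpr hτ)
  -- The derivative `1 + σ` is nonzero, so the points `τ = 1 - e^{-s} + σ s` fill a neighbourhood of
  -- `0`. There the equation holds because `v = s`.
  have hg : HasStrictDerivAt (fun s : ℂ => 1 - Complex.exp (-s) + σ * s) (1 + σ) 0 := by
    have := (((hasStrictDerivAt_id (0 : ℂ)).neg.cexp).const_sub 1).add
      ((hasStrictDerivAt_id (0 : ℂ)).const_mul σ)
    refine this.congr_deriv ?_
    simp
  have hne : 1 + σ ≠ 0 := fun h => by
    rw [show σ = -1 by linear_combination h] at hσ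
    norm_num at hσ
  have hmap := hg.map_nhds_eq hne
  simp only [neg_zero, Complex.exp_zero, sub_self, mul_zero, add_zero] at hmap
  rw [← hmap, EventuallyEq, eventually_map]
  filter_upwards [eventually_series_characteristic hσ] with s hs
  rw [hs]
  ring

theorem continuousOn_series_real {a b : ℝ} (ha : ‖a‖ < 1 / 4) (hb : ‖b‖ < 1 / 4) :
    ContinuousOn (fun t : ℝ => (series a ((t * b : ℝ) : ℂ)).re) (Set.Icc 0 1) := by
  have hd := (differentiableOn_series a (by simpa using ha)).continuousOn
  refine Complex.continuous_re.comp_continuousOn (hd.comp (by fun_prop) fun t ht => ?_)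
  rw [mem_ball_zero_iff, Complex.norm_real, norm_mul]
  rw [Real.norm_of_nonneg ht.1]
  nlinarith [ht.2, norm_nonneg b]

/-- Since `c_{l,m}` has sign `(-1)^l`, the value at `(-|σ|, |τ|)` majorizes the series. If that real
value were at least `1`, then by continuity it would equal `1` at some `(-|σ|, t|τ|)`, where the
functional equation reads `e^{-1} = 1 - t|τ| - |σ| > 1/2`. -/
theorem norm_series_lt_one {σ τ : ℂ} (hσ : ‖σ‖ < 1 / 4) (hτ : ‖τ‖ < 1 / 4) :
    ‖series σ τ‖ < 1 := by
  have hσ' : ‖((-‖σ‖ : ℝ) : ℂ)‖ < 1 / 4 := by simpa using hσ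
  have hterm (t : ℝ) (p : ℕ × ℕ) : seriesTerm ((-‖σ‖ : ℝ) : ℂ) (t : ℂ) p
      = (((-1) ^ p.1 * c p.1 p.2 * ‖σ‖ ^ p.1 * t ^ p.2 : ℝ) : ℂ) := by
    rw [seriesTerm]
    push_cast
    rw [neg_pow]
    ring
  have hreal (t : ℝ) : ∃ x : ℝ, series ((-‖σ‖ : ℝ) : ℂ) (t : ℂ) = x :=
    ⟨∑' p : ℕ × ℕ, ((-1) ^ p.1 * c p.1 p.2 * ‖σ‖ ^ p.1 * t ^ p.2 : ℝ), by
      rw [series, Complex.ofReal_tsum]; exact tsum_congr (hterm t)⟩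
  have hlt : (series ((-‖σ‖ : ℝ) : ℂ) ((1 * ‖τ‖ : ℝ) : ℂ)).re < 1 := by
    by_contra! hge
    have h0 : (series ((-‖σ‖ : ℝ) : ℂ) ((0 * ‖τ‖ : ℝ) : ℂ)).re ≤ 1 := by
      simp [series_zero_right]
    obtain ⟨t, ht, hVt⟩ := intermediate_value_Icc zero_le_one
      (continuousOn_series_real (a := -‖σ‖) (b := ‖τ‖) (by simpa using hσ) (by simpa using hτ))
      ⟨h0, hge⟩
    obtain ⟨x, hx⟩ := hreal (t * ‖τ‖)
    have htτ : t * ‖τ‖ < 1 / 4 := by nlinarith [ht.2, norm_nonneg τ]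
    have htτ0 : 0 ≤ t * ‖τ‖ := mul_nonneg ht.1 (norm_nonneg τ)
    have he := exp_neg_series hσ' (τ := ((t * ‖τ‖ : ℝ) : ℂ)) (by
      rw [Complex.norm_real, Real.norm_of_nonneg htτ0]; exact htτ)
    simp only [hx, Complex.ofReal_re] at hVt
    rw [hx, hVt] at he
    have he' : Real.exp (-1) = 1 - t * ‖τ‖ + -‖σ‖ * 1 := by
      exact_mod_cast he
    have := Real.exp_neg_one_lt_half
    linarith
  refine lt_of_le_of_lt ?_ hlt
  have hs := Complex.hasSum_re (hasSum_series hσ' (τ := ((1 * ‖τ‖ : ℝ) : ℂ)) (by simpa using hτ))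
  refine tsum_of_norm_bounded hs fun p => le_of_eq ?_
  rw [hterm, Complex.ofReal_re, seriesTerm, norm_mul, norm_mul, norm_pow, norm_pow, one_mul,
    Complex.norm_real, c, Real.norm_eq_abs, abs_mul, abs_div, abs_pow, abs_neg, abs_one, one_pow,
    Nat.abs_cast, Nat.abs_cast]
  have : ((-1 : ℝ) ^ p.1) * (-1) ^ p.1 = 1 := by rw [← mul_pow]; simp
  linear_combination (-(1 / (p.2.factorial : ℝ) * (Nat.stirlingFirst (p.1 + p.2) (p.1 + 1) : ℝ)
    * ‖σ‖ ^ p.1 * ‖τ‖ ^ p.2)) * this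

end Series

/-! ### Branch ranges in terms of logarithms. -/

section BranchRanges

open Real

theorem sin_nonneg_of_le_of_le {n : ℤ} {x : ℝ} (h1 : 2 * n * π ≤ x) (h2 : x ≤ (2 * n + 1) * π) :
    0 ≤ sin x := by
  rw [← sin_sub_int_mul_two_pi x n]
  exact sin_nonneg_of_nonneg_of_le_pi (by linarith) (by linarith)

theorem sin_neg_of_lt_of_lt {n : ℤ} {x : ℝ} (h1 : (2 * n - 1) * π < x) (h2 : x < 2 * n * π) :
    sin x < 0 := by
  rw [← sin_sub_int_mul_two_pi x n]
  exact sin_neg_of_neg_of_neg_pi_lt (by linarith) (by linarith)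

/-- This turns the side of a boundary curve on which `w = e^u` lies into the position of `Im (w +
u)` relative to multiples of `π`. -/
theorem curveFun_exp_mul_im (u : ℂ) :
    curveFun (Complex.exp u) * (Complex.exp u).im
      = rexp u.re * sin ((Complex.exp u).im + u.im) := by
  have h : sinc (Complex.exp u).im * (Complex.exp u).im = sin (Complex.exp u).im := by
    by_cases h0 : (Complex.exp u).im = 0
    · simp [h0]
    · rw [sinc_of_ne_zero h0, div_mul_cancel₀ _ h0]
  rw [curveFun, add_mul, mul_assoc, h, sin_add]
  nth_rw 1 [Complex.exp_re]
  nth_rw 3 [Complex.exp_im]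
  ring

theorem exp_mem_branchRange {k : ℤ} {u : ℂ}
    (h1 : (2 * (k : ℝ) - 1) * π < (Complex.exp u).im + u.im)
    (h2 : (Complex.exp u).im + u.im ≤ (2 * (k : ℝ) + 1) * π) (hu : |u.im| < π) :
    Complex.exp u ∈ branchRange k := by
  have hc := curveFun_exp_mul_im u
  have him := Complex.exp_im u
  have hre := Complex.exp_re u
  set w := Complex.exp u
  have hr := exp_pos u.re
  have hπ := pi_pos
  obtain ⟨hu1, hu2⟩ := abs_lt.mp hu
  have hpos : 0 < w.im → 0 < u.im := fun h => by
    by_contra! h'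
    have := sin_nonpos_of_nonpos_of_neg_pi_le h' hu1.le
    nlinarith
  have hneg : w.im < 0 → u.im < 0 := fun h => by
    by_contra! h'
    have := sin_nonneg_of_nonneg_of_le_pi h' hu2.le
    nlinarith
  have hzero : w.im = 0 → u.im = 0 := fun h => by
    rw [h, eq_comm, mul_eq_zero] at him
    exact (sin_eq_zero_iff_of_lt_of_lt hu1 hu2).mp (him.resolve_left hr.ne')
  rcases lt_trichotomy k 0 with hk | hk | hk
  · have hk1 : (k : ℝ) ≤ -1 := by exact_mod_cast (by omega : k ≤ -1)
    have hw : w.im < 0 := by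
      by_contra! h
      rcases h.eq_or_lt with h | h
      · have := hzero h.symm
        nlinarith
      · have := hpos h
        nlinarith
    have hui := hneg hw
    rw [branchRange, if_neg hk.ne, if_neg hk.not_gt]
    refine ⟨by linarith, by linarith, fun h => ?_, fun h => ?_⟩
    · have hs := sin_nonneg_of_le_of_le (n := k) (x := w.im + u.im) (by linarith) h2
      by_contra! hcur
      nlinarith
    · have hs := sin_neg_of_lt_of_lt (n := k) (x := w.im + u.im) h1 (by linarith)
      by_contra! hcur
      nlinarith
  · subst hk
    rw [branchRange, if_pos rfl]
    simp only [Int.cast_zero, mul_zero, zero_sub, zero_add, neg_mul, one_mul] at h1 h2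
    rcases lt_trichotomy w.im 0 with hw | hw | hw
    · have hui := hneg hw
      refine ⟨abs_lt.mpr ⟨by linarith, by linarith⟩, Or.inl ?_⟩
      have hs := sin_neg_of_neg_of_neg_pi_lt (x := w.im + u.im) (by linarith) h1
      by_contra! hcur
      nlinarith
    · refine ⟨by rw [hw, abs_zero]; exact hπ, Or.inl ?_⟩
      rw [curveFun, hw, hre, hzero hw]
      simp
      positivity
    · have hui := hpos hw
      refine ⟨abs_lt.mpr ⟨by linarith, by linarith⟩, ?_⟩
      have hs := sin_nonneg_of_nonneg_of_le_pi (x := w.im + u.im) (by linarith) h2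
      have : 0 ≤ curveFun w := by
        by_contra! hcur
        nlinarith
      rcases this.eq_or_lt with h | h
      · exact Or.inr ⟨h.symm, hw.le⟩
      · exact Or.inl h
  · have hk1 : (1 : ℝ) ≤ k := by exact_mod_cast hk
    have hw : 0 < w.im := by
      by_contra! h
      rcases h.eq_or_lt with h | h
      · have := hzero h
        nlinarith
      · have := hneg h
        nlinarith
    have hui := hpos hw
    rw [branchRange, if_neg hk.ne', if_pos hk]
    refine ⟨by linarith, by linarith, fun h => ?_, fun h => ?_⟩
    · have hs := sin_neg_of_lt_of_lt (n := k) (x := w.im + u.im) h1 (by linarith)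
      by_contra! hcur
      nlinarith
    · have hs := sin_nonneg_of_le_of_le (n := k) (x := w.im + u.im) (by linarith) h2
      by_contra! hcur
      nlinarith

/-- Every nonzero `w` in the range of the `k`-th branch has a logarithm `u` for which `w + u` lies
in the `k`-th period strip. -/
theorem exists_log_of_mem_branchRange {k : ℤ} {w : ℂ} (hw0 : w ≠ 0) (hw : w ∈ branchRange k) :
    ∃ u : ℂ, Complex.exp u = w ∧ (2 * (k : ℝ) - 1) * π < w.im + u.im ∧
      w.im + u.im ≤ (2 * (k : ℝ) + 1) * π ∧ |u.im| ≤ π ∧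
      (u.im = π → u.re ≤ 0) ∧ (u.im = -π → 0 ≤ u.re) := by
  have hπ := pi_pos
  have hr := exp_pos (Complex.log w).re
  have hexp := Complex.exp_log hw0
  have hc := curveFun_exp_mul_im (Complex.log w)
  have hre : (Complex.log w).re = log ‖w‖ := Complex.log_re w
  rw [hexp, Complex.log_im] at hc
  have habs := Complex.abs_arg_le_pi w
  have hlow := Complex.neg_pi_lt_arg w
  have hpos : 0 < w.im → 0 < w.arg ∧ w.arg < π := fun h =>
    ⟨(Complex.arg_nonneg_iff.mpr h.le).lt_of_ne fun h0 =>
      h.ne' (Complex.arg_eq_zero_iff.mp h0.symm).2,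
     (Complex.arg_le_pi w).lt_of_ne fun h0 => h.ne' (Complex.arg_eq_pi_iff.mp h0).2⟩
  have hneg : w.im < 0 → w.arg < 0 := Complex.arg_neg_iff.mpr
  rcases lt_trichotomy k 0 with hk | hk | hk
  · have hk1 : (k : ℝ) ≤ -1 := by exact_mod_cast (by omega : k ≤ -1)
    rw [branchRange, if_neg hk.ne, if_neg hk.not_gt] at hw
    obtain ⟨b1, b2, b3, b4⟩ := hw
    have hw' : w.im ≤ 0 := by nlinarith
    rcases hw'.lt_or_eq with hwi | hwi
    · have ha := hneg hwi
      refine ⟨Complex.log w, hexp, ?_, ?_, by rwa [Complex.log_im], ?_, ?_⟩ <;>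
        rw [Complex.log_im]
      -- Outside the strip, `Im (w + u)` would fall in an adjacent half-period, where the sine has
      -- the wrong sign for `curveFun w`. The other cases use the same argument.
      · by_contra! h
        have hs := sin_nonneg_of_le_of_le (n := k - 1) (x := w.im + w.arg)
          (by push_cast; linarith) (by push_cast; linarith)
        have := b4 (by linarith)
        nlinarith
      · by_contra! h
        have hs := sin_neg_of_lt_of_lt (n := k + 1) (x := w.im + w.arg)
          (by push_cast; linarith) (by push_cast; linarith)
        have := b3 (by linarith)
        nlinarith
      · intro h; linarith
      · intro h; linarith
    · have hk' : k = -1 := by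
        have : (-2 : ℝ) < k := by
          rw [hwi] at b2
          by_contra! h
          nlinarith
        have : -2 < k := by exact_mod_cast this
        omega
      subst hk'
      have hcur := b3 (by rw [hwi]; push_cast; linarith)
      simp [curveFun, hwi] at hcur
      have harg : w.arg = π := Complex.arg_eq_pi_iff.mpr ⟨by linarith, hwi⟩
      -- On the ray `w ≤ -1`, seen from `W_{-1}`, the logarithm with imaginary part `-π` is the
      -- right one.
      refine ⟨Complex.log w - 2 * π * Complex.I, ?_, ?_, ?_, ?_, ?_, ?_⟩
      · rw [Complex.exp_sub, hexp, Complex.exp_two_pi_mul_I, div_one]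
      · simp [Complex.log_im, harg, hwi]; linarith
      · simp [Complex.log_im, harg, hwi]; linarith
      · simp only [Complex.sub_im, Complex.log_im, harg, Complex.mul_I_im]
        rw [abs_le]
        constructor <;> simp <;> linarith
      · simp [Complex.log_im, harg]
      · intro _
        have him : (Complex.log w - 2 * π * Complex.I).re = log ‖w‖ := by simp [Complex.log_re]
        rw [him]
        refine log_nonneg ?_
        have := Complex.abs_re_le_norm w
        rw [abs_of_neg (by linarith)] at this
        linarith
  · subst hk
    rw [branchRange, if_pos rfl] at hw
    obtain ⟨b1, b2⟩ := hw
    obtain ⟨b3, b4⟩ := abs_lt.mp b1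
    have hcur : 0 ≤ curveFun w := by rcases b2 with h | h <;> linarith
    refine ⟨Complex.log w, hexp, ?_, ?_, by rwa [Complex.log_im], ?_, ?_⟩ <;>
      rw [Complex.log_im]
    · simp only [Int.cast_zero, mul_zero, zero_sub, neg_mul, one_mul]
      rcases lt_or_ge w.im 0 with hwi | hwi
      · have ha := hneg hwi
        by_contra! h
        have hs := sin_nonneg_of_le_of_le (n := -1) (x := w.im + w.arg)
          (by push_cast; linarith) (by push_cast; linarith)
        have : 0 < curveFun w := by
          rcases b2 with h | h
          · exact h
          · linarith [h.2]
        nlinarith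
      · linarith
    · simp only [Int.cast_zero, mul_zero, zero_add, one_mul]
      rcases lt_or_ge 0 w.im with hwi | hwi
      · have ha := hpos hwi
        by_contra! h
        have hs := sin_neg_of_lt_of_lt (n := 1) (x := w.im + w.arg)
          (by push_cast; linarith) (by push_cast; linarith)
        nlinarith
      · linarith [Complex.arg_le_pi w]
    · intro h
      rw [hre]
      obtain ⟨h1, h2⟩ := Complex.arg_eq_pi_iff.mp h
      simp [curveFun, h2] at hcur
      refine log_nonpos (norm_nonneg _) ?_
      rw [← Complex.abs_re_eq_norm.mpr h2, abs_of_neg h1]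
      linarith
    · intro h; linarith
  · have hk1 : (1 : ℝ) ≤ k := by exact_mod_cast hk
    rw [branchRange, if_neg hk.ne', if_pos hk] at hw
    obtain ⟨b1, b2, b3, b4⟩ := hw
    have hwi : 0 < w.im := by nlinarith
    obtain ⟨ha, ha'⟩ := hpos hwi
    refine ⟨Complex.log w, hexp, ?_, ?_, by rwa [Complex.log_im], ?_, ?_⟩ <;>
      rw [Complex.log_im]
    · by_contra! h
      have hs := sin_nonneg_of_le_of_le (n := k - 1) (x := w.im + w.arg)
        (by push_cast; linarith) (by push_cast; linarith)
      have := b3 (by linarith)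
      nlinarith
    · by_contra! h
      have hs := sin_neg_of_lt_of_lt (n := k + 1) (x := w.im + w.arg)
        (by push_cast; linarith) (by push_cast; linarith)
      have := b4 (by linarith)
      nlinarith
    · intro h; linarith
    · intro h; linarith

/-! ### Injectivity of `u ↦ u + e^u`. -/

theorem sinh_lt_mul_cosh {a : ℝ} (ha : 0 < a) : sinh a < a * cosh a := by
  obtain ⟨t, ht, h⟩ := exists_deriv_eq_slope sinh ha continuous_sinh.continuousOn
    differentiable_sinh.differentiableOn
  rw [Real.deriv_sinh, sinh_zero, sub_zero, sub_zero, eq_div_iff ha.ne'] at h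
  have := cosh_strictMonoOn (Set.mem_Ici.mpr ht.1.le) (Set.mem_Ici.mpr ha.le) ht.2
  nlinarith

/-- With `c = a + ib` half the difference of two points and `X + iY` their midpoint, `N = e^X`,
equality of the images reads `N e^{iY} sinh c = -c`. The argument of `sinh c / c` lies strictly
between `0` and `b`, which would force `Y + b > π`. -/
theorem add_exp_ne_aux {N Y a b : ℝ} (hN : 0 < N) (ha : 0 < a) (hb : 0 < b)
    (hY1 : -π ≤ Y - b) (hY2 : Y + b ≤ π)
    (h1 : N * (cos Y * sinh a * cos b - sin Y * cosh a * sin b) = -a)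
    (h2 : N * (sin Y * sinh a * cos b + cos Y * cosh a * sin b) = -b) : False := by
  have hbπ : b ≤ π := by linarith
  have hsb : 0 ≤ sin b := sin_nonneg_of_nonneg_of_le_pi hb.le hbπ
  have hsa : a < sinh a := self_lt_sinh_iff.mpr ha
  have hca : 0 < cosh a := cosh_pos a
  have hexp : cosh a - sinh a = rexp (-a) := cosh_sub_sinh a
  have hexp1 : rexp (-a) < 1 := exp_lt_one_iff.mpr (by linarith)
  have hexp0 := exp_pos (-a)
  have hcsY := sin_sq_add_cos_sq Y
  have hcsb := sin_sq_add_cos_sq b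
  have hD : 0 < a ^ 2 + b ^ 2 := by positivity
  -- `p + iq = conj(c) sinh c`, a positive multiple of `sinh c / c`. `hqpos` says that its argument
  -- is positive, `hrot` that it is less than `b`.
  obtain ⟨p, hp⟩ : ∃ p, p = a * sinh a * cos b + b * cosh a * sin b := ⟨_, rfl⟩
  obtain ⟨q, hq⟩ : ∃ q, q = a * cosh a * sin b - b * sinh a * cos b := ⟨_, rfl⟩
  have e1 : N * (cos Y * p - sin Y * q) = -(a ^ 2 + b ^ 2) := by
    rw [hp, hq]; linear_combination a * h1 + b * h2
  have e2 : cos Y * q + sin Y * p = 0 := by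
    refine (mul_eq_zero.mp ?_ : N = 0 ∨ _).resolve_left hN.ne'
    rw [hp, hq]; linear_combination a * h2 - b * h1
  have e3 : N * q = (a ^ 2 + b ^ 2) * sin Y := by
    linear_combination (-sin Y) * e1 + N * cos Y * e2 - N * q * hcsY
  have e4 : N * p = -(a ^ 2 + b ^ 2) * cos Y := by
    linear_combination cos Y * e1 + N * sin Y * e2 - N * p * hcsY
  have hqpos : 0 < q := by
    have hcosh : sinh a < a * cosh a := sinh_lt_mul_cosh ha
    rcases lt_or_ge (cos b) 0 with hc | hc
    · have : 0 ≤ a * cosh a * sin b := by positivity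
      nlinarith [mul_pos (mul_pos hb (ha.trans hsa)) (neg_pos.mpr hc)]
    · have hbc : b * cos b ≤ sin b := by
        rcases lt_or_ge b (π / 2) with h | h
        · have hcb := cos_pos_of_mem_Ioo ⟨by linarith, h⟩
          have := lt_tan hb h
          rw [tan_eq_sin_div_cos, lt_div_iff₀ hcb] at this
          exact this.le
        · have := cos_nonpos_of_pi_div_two_le_of_le h (by linarith)
          nlinarith
      rcases hc.eq_or_lt with hc | hc
      · have : 0 < sin b := hsb.lt_of_ne fun h => by
          rw [← h, ← hc] at hcsb
          norm_num at hcsb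
        rw [hq, ← hc, mul_zero, sub_zero]
        positivity
      · have h3 : (a * cosh a) * (b * cos b) ≤ a * cosh a * sin b :=
          mul_le_mul_of_nonneg_left hbc (by positivity)
        have h4 : sinh a * (b * cos b) < a * cosh a * (b * cos b) :=
          mul_lt_mul_of_pos_right hcosh (by positivity)
        rw [hq]
        linarith
  have hrot : q * cos b - p * sin b < 0 := by
    have e5 : q * cos b - p * sin b
        = a * rexp (-a) * (sin b * cos b) - b * (sinh a + rexp (-a) * sin b ^ 2) := by
      rw [hp, hq, ← hexp]; linear_combination (-b * sinh a) * hcsb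
    have h3 : sin b * cos b ≤ b := by nlinarith [cos_le_one b, sin_le hb.le]
    have h4 : a * rexp (-a) * (sin b * cos b) ≤ a * rexp (-a) * b :=
      mul_le_mul_of_nonneg_left h3 (by positivity)
    have h5 : a * rexp (-a) < sinh a := by nlinarith
    have h6 : 0 ≤ b * (rexp (-a) * sin b ^ 2) := by positivity
    have h7 := mul_lt_mul_of_pos_right h5 hb
    rw [e5]
    linarith
  have hsY : 0 < sin Y := by
    have : 0 < N * q := mul_pos hN hqpos
    rw [e3] at this
    exact (mul_pos_iff_of_pos_left hD).mp this
  have hYpos : 0 < Y := by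
    by_contra! h
    exact hsY.not_ge (sin_nonpos_of_nonpos_of_neg_pi_le h (by linarith))
  have hYb : 0 ≤ sin (Y + b) := sin_nonneg_of_nonneg_of_le_pi (by linarith) hY2
  have e6 : N * (q * cos b - p * sin b) = (a ^ 2 + b ^ 2) * sin (Y + b) := by
    rw [sin_add]; linear_combination cos b * e3 - sin b * e4
  have e7 : N * (q * cos b - p * sin b) < 0 := mul_neg_of_pos_of_neg hN hrot
  have e8 : 0 ≤ (a ^ 2 + b ^ 2) * sin (Y + b) := by positivity
  linarith

/-- `e^x - x` is strictly monotone on each side of `0`. On the lines `Im u = ±π` the map `u + e^u`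
reduces to it, which is why only half of each line is kept. -/
theorem exp_sub_exp_ne {x y : ℝ} (hxy : x < y) (h : y ≤ 0 ∨ 0 ≤ x) :
    rexp y - rexp x ≠ y - x := by
  intro he
  rcases h with h | h
  · have h1 := add_one_lt_exp (x := x - y) (by linarith)
    have h2 : rexp x = rexp y * rexp (x - y) := by rw [← exp_add]; ring_nf
    have h3 := exp_le_one_iff.mpr h
    have h4 := exp_pos y
    nlinarith
  · have h1 := add_one_lt_exp (x := y - x) (by linarith)
    have h2 : rexp y = rexp x * rexp (y - x) := by rw [← exp_add]; ring_nf
    have h3 := one_le_exp h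
    nlinarith

theorem no_horizontal {X Y a : ℝ} (ha : 0 < a) (hY : -π ≤ Y ∧ Y ≤ π)
    (hX1 : Y = π → X + a ≤ 0) (hX2 : Y = -π → 0 ≤ X - a)
    (h1 : rexp X * (cos Y * sinh a) = -a) (h2 : rexp X * (sin Y * sinh a) = 0) : False := by
  have hs : 0 < sinh a := sinh_pos_iff.mpr ha
  have hN := exp_pos X
  have hsY : sin Y = 0 := by simpa [hs.ne'] using h2
  have key (hc : cos Y = -1) (h : X + a ≤ 0 ∨ 0 ≤ X - a) : False := by
    refine exp_sub_exp_ne (x := X - a) (y := X + a) (by linarith) h ?_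
    rw [hc, sinh_eq] at h1
    rw [sub_eq_add_neg X, exp_add, exp_add]
    linear_combination -2 * h1
  rcases hY.1.eq_or_lt with h | h
  · exact key (by rw [← h]; simp) (Or.inr (hX2 h.symm))
  rcases hY.2.eq_or_lt with h' | h'
  · exact key (by rw [h']; simp) (Or.inl (hX1 h'))
  rw [(sin_eq_zero_iff_of_lt_of_lt h h').mp hsY, cos_zero, one_mul] at h1
  have := mul_pos hN hs
  linarith

/-- The map `u ↦ u + e^u` is injective on the strip `|Im u| ≤ π` with half of each boundary line
removed. -/
theorem eq_of_exp_add_eq {u v : ℂ} (hu : |u.im| ≤ π) (hv : |v.im| ≤ π)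
    (hu1 : u.im = π → u.re ≤ 0) (hu2 : u.im = -π → 0 ≤ u.re)
    (hv1 : v.im = π → v.re ≤ 0) (hv2 : v.im = -π → 0 ≤ v.re)
    (h : Complex.exp u + u = Complex.exp v + v) : u = v := by
  have hre := congrArg Complex.re h
  have him := congrArg Complex.im h
  rw [Complex.add_re, Complex.add_re, Complex.exp_re, Complex.exp_re] at hre
  rw [Complex.add_im, Complex.add_im, Complex.exp_im, Complex.exp_im] at him
  obtain ⟨x₁, y₁⟩ := u
  obtain ⟨x₂, y₂⟩ := v
  simp only at *
  obtain ⟨X, a, rfl, rfl⟩ : ∃ X a, x₁ = X + a ∧ x₂ = X - a :=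
    ⟨(x₁ + x₂) / 2, (x₁ - x₂) / 2, by ring, by ring⟩
  obtain ⟨Y, b, rfl, rfl⟩ : ∃ Y b, y₁ = Y + b ∧ y₂ = Y - b :=
    ⟨(y₁ + y₂) / 2, (y₁ - y₂) / 2, by ring, by ring⟩
  rw [abs_le] at hu hv
  have hN := exp_pos X
  have h1 : rexp X * (cos Y * sinh a * cos b - sin Y * cosh a * sin b) = -a := by
    rw [sub_eq_add_neg X, exp_add, exp_add, cos_add, cos_sub] at hre
    rw [sinh_eq, cosh_eq]
    linear_combination hre / 2
  have h2 : rexp X * (sin Y * sinh a * cos b + cos Y * cosh a * sin b) = -b := by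
    rw [sub_eq_add_neg X, exp_add, exp_add, sin_add, sin_sub] at him
    rw [sinh_eq, cosh_eq]
    linear_combination him / 2
  rcases lt_trichotomy a 0 with ha | ha | ha
  -- Exchanging the points negates `a` and `b`, conjugation negates `b` and `Y`; this reduces all
  -- sign patterns to `a, b > 0`.
  · rcases lt_trichotomy b 0 with hb | hb | hb
    · exact (add_exp_ne_aux (a := -a) (b := -b) (Y := Y) hN (by linarith) (by linarith)
        (by linarith) (by linarith) (by simp; linarith) (by simp; linarith)).elim
    · subst hb
      exact (no_horizontal (X := X) (Y := Y) (a := -a) (by linarith) ⟨by linarith, by linarith⟩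
        (fun h => by simpa using hv1 (by simpa using h))
        (fun h => by simpa using hu2 (by simpa using h)) (by simp at h1 ⊢; linarith)
        (by simp at h2 ⊢; tauto)).elim
    · exact (add_exp_ne_aux (a := -a) (b := b) (Y := -Y) hN (by linarith) (by linarith)
        (by linarith) (by linarith) (by simp; linarith) (by simp; linarith)).elim
  · subst ha
    by_cases hb : b = 0
    · simp [hb]
    exfalso
    simp at h1 h2
    have hsb : sin b ≠ 0 := fun h0 => hb (by rw [h0] at h2; simpa using h2.symm)
    have hY : sin Y = 0 := h1.resolve_right hsb
    have hY0 : Y = 0 := by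
      rcases lt_or_gt_of_ne hb with hb | hb <;>
        exact (sin_eq_zero_iff_of_lt_of_lt (by linarith) (by linarith)).mp hY
    rw [hY0, cos_zero, one_mul] at h2
    rcases lt_or_gt_of_ne hb with hb | hb
    · have := sin_nonpos_of_nonpos_of_neg_pi_le hb.le (by linarith)
      nlinarith
    · have := sin_nonneg_of_nonneg_of_le_pi hb.le (by linarith)
      nlinarith
  · rcases lt_trichotomy b 0 with hb | hb | hb
    · exact (add_exp_ne_aux (a := a) (b := -b) (Y := -Y) hN (by linarith) (by linarith)
        (by linarith) (by linarith) (by simp; linarith) (by simp; linarith)).elim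
    · subst hb
      exact (no_horizontal (X := X) (Y := Y) (a := a) (by linarith) ⟨by linarith, by linarith⟩
        (fun h => hu1 (by simpa using h)) (fun h => hv2 (by simpa using h))
        (by simpa using h1) (by simpa using h2)).elim
    · exact (add_exp_ne_aux hN ha hb (by linarith) (by linarith) h1 h2).elim

theorem log_add_eq {k : ℤ} {z s : ℂ} (hs : Complex.exp s = z)
    (h1 : (2 * (k : ℝ) - 1) * π < s.im) (h2 : s.im ≤ (2 * (k : ℝ) + 1) * π) : s = L₁ k z := by
  have he : Complex.exp (s - k * (2 * π * Complex.I)) = z := by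
    rw [Complex.exp_sub, Complex.exp_int_mul_two_pi_mul_I, div_one, hs]
  have hl := Complex.log_exp (x := s - k * (2 * π * Complex.I)) (by simp; linarith)
    (by simp; linarith)
  rw [L₁, ← he, hl]
  ring

/-- The strip determines the logarithm of `z`, so `w + u = L₁ = w' + u'`, and injectivity applies.
-/
theorem eq_of_mem_branchRange {k : ℤ} {w w' z : ℂ} (hz : z ≠ 0) (hw : w ∈ branchRange k)
    (hw' : w' ∈ branchRange k) (h : w * Complex.exp w = z) (h' : w' * Complex.exp w' = z) :
    w = w' := by
  have hw0 : w ≠ 0 := fun h0 => hz (by rw [← h, h0, zero_mul])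
  have hw0' : w' ≠ 0 := fun h0 => hz (by rw [← h', h0, zero_mul])
  obtain ⟨u, hu, a1, a2, a3, a4, a5⟩ := exists_log_of_mem_branchRange hw0 hw
  obtain ⟨u', hu', b1, b2, b3, b4, b5⟩ := exists_log_of_mem_branchRange hw0' hw'
  have e1 : w + u = L₁ k z := log_add_eq (by rw [Complex.exp_add, hu, mul_comm, h])
    (by simpa using a1) (by simpa using a2)
  have e2 : w' + u' = L₁ k z := log_add_eq (by rw [Complex.exp_add, hu', mul_comm, h'])
    (by simpa using b1) (by simpa using b2)
  rw [← hu, ← hu', eq_of_exp_add_eq a3 b3 a4 a5 b4 b5 (by rw [hu, hu', e1, e2])]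

theorem W_eq {k : ℤ} {w z : ℂ} (hz : z ≠ 0) (hw : w ∈ branchRange k)
    (h : w * Complex.exp w = z) : W k z = w := by
  have hex : ∃ w : ℂ, w ∈ branchRange k ∧ w * Complex.exp w = z := ⟨w, hw, h⟩
  rw [W, dif_pos hex]
  exact eq_of_mem_branchRange hz hex.choose_spec.1 hw hex.choose_spec.2 h

end BranchRanges

/-! ### The branch of the series solution. -/

section Expansion

open Real

theorem L₁_im (k : ℤ) (z : ℂ) : (L₁ k z).im = z.arg + 2 * k * π := by
  simp [L₁, Complex.log_im]
  ring

theorem L₁_re (k : ℤ) (z : ℂ) : (L₁ k z).re = log ‖z‖ := by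
  simp [L₁, Complex.log_re]

theorem L₁_ne_zero {k : ℤ} {z : ℂ} (hk : k = 0 → 1 < ‖z‖) : L₁ k z ≠ 0 := by
  intro h
  have hre := L₁_re k z
  have him := L₁_im k z
  rw [h] at hre him
  simp only [Complex.zero_re, Complex.zero_im] at hre him
  by_cases h0 : k = 0
  · exact (log_pos (hk h0)).ne hre
  · have h1 := Complex.neg_pi_lt_arg z
    have h2 := Complex.arg_le_pi z
    have hπ := pi_pos
    rcases lt_or_gt_of_ne h0 with h0 | h0
    · have : (k : ℝ) ≤ -1 := by exact_mod_cast (by omega : k ≤ -1)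
      nlinarith
    · have : (1 : ℝ) ≤ k := by exact_mod_cast h0
      nlinarith

theorem exp_L₁ (k : ℤ) {z : ℂ} (hz : z ≠ 0) : Complex.exp (L₁ k z) = z := by
  rw [L₁, Complex.exp_add, Complex.exp_log hz,
    show 2 * (π : ℂ) * k * Complex.I = k * (2 * π * Complex.I) by ring,
    Complex.exp_int_mul_two_pi_mul_I, mul_one]

/-- For `δ ≤ 1`, `sin δ ≥ 3δ/4`, while `4/e > 1.4`. The value `4/e` bounds `|e^u|` from below, from
`|L₁| > 4` and `|v| < 1`. -/
theorem self_lt_mul_sin {δ r : ℝ} (h0 : 0 < δ) (h1 : δ ≤ 1) (hr : 4 * rexp (-1) ≤ r) :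
    δ < r * sin δ := by
  have hs := sin_gt_sub_cube h0
  have he := exp_neg_one_gt_d9
  have hs' : 3 / 4 * δ ≤ δ - δ ^ 3 / 6 := by
    nlinarith [mul_nonneg h0.le h0.le, mul_nonneg h0.le (sub_nonneg.mpr h1)]
  have hr' : (1.4 : ℝ) ≤ r := by linarith
  have : 0 < sin δ := by linarith
  nlinarith

/-- Subtracting a number of norm less than `1` from `L₂` gives a logarithm of a point in the range
of the `k`-th branch. -/
theorem exp_L₂_sub_mem_branchRange {k : ℤ} {z v : ℂ} (hk : k = 0 → 1 < ‖z‖) (hL : 4 < ‖L₁ k z‖)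
    (hv : ‖v‖ < 1) (h : Complex.exp (L₂ k z - v) + (L₂ k z - v) = L₁ k z) :
    Complex.exp (L₂ k z - v) ∈ branchRange k := by
  have hπ := pi_gt_three
  have harg1 := Complex.neg_pi_lt_arg z
  have harg2 := Complex.arg_le_pi z
  have hLim := L₁_im k z
  have him := congrArg Complex.im h
  rw [Complex.add_im] at him
  have hvi := (Complex.abs_im_le_norm v).trans_lt hv
  have hvr := (Complex.abs_re_le_norm v).trans_lt hv
  rw [abs_lt] at hvi hvr
  have hui : (L₂ k z - v).im = (L₁ k z).arg - v.im := by
    rw [L₂, Complex.sub_im, Complex.log_im]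
  have hur : (L₂ k z - v).re = log ‖L₁ k z‖ - v.re := by
    rw [L₂, Complex.sub_re, Complex.log_re]
  have hexpim := Complex.exp_im (L₂ k z - v)
  have hexpre := Complex.exp_re (L₂ k z - v)
  have hr : 4 * rexp (-1) ≤ rexp (L₂ k z - v).re := by
    rw [hur, sub_eq_add_neg, exp_add, exp_log (by linarith)]
    exact mul_le_mul hL.le (exp_le_exp.mpr (by linarith)) (exp_pos _).le (by linarith)
  have ha1 := Complex.neg_pi_lt_arg (L₁ k z)
  have ha2 := Complex.arg_le_pi (L₁ k z)
  set u := L₂ k z - v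
  have hmem (hu : |u.im| < π) : Complex.exp u ∈ branchRange k :=
    exp_mem_branchRange (by rw [him, hLim]; linarith) (by rw [him, hLim]; linarith) hu
  rcases lt_trichotomy k 0 with h0 | h0 | h0
  · have hk1 : (k : ℝ) ≤ -1 := by exact_mod_cast (by omega : k ≤ -1)
    have hLneg : (L₁ k z).im ≤ -π := by nlinarith
    have harg : (L₁ k z).arg < 0 := Complex.arg_neg_iff.mpr (by linarith)
    rcases lt_or_ge (-π) u.im with hu | hu
    · exact hmem (abs_lt.mpr ⟨hu, by linarith⟩)
    -- If `Im u` overshoots `-π` by `δ`, then `Im L₁ ≤ -π` gives `|e^u| sin δ ≤ δ`, hence `δ = 0`.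
    -- This leaves only `w ≤ -1`, which belongs to the range of `W_{-1}`.
    obtain ⟨δ, hδ⟩ : ∃ δ, u.im = -π - δ := ⟨-π - u.im, by ring⟩
    have hsin : sin u.im = sin δ := by
      rw [hδ, ← neg_add', sin_neg, add_comm, sin_add_pi, neg_neg]
    rw [hsin] at hexpim
    have hδ0 : δ = 0 := by
      by_contra hne
      have := self_lt_mul_sin (lt_of_le_of_ne (by linarith) (Ne.symm hne)) (by linarith) hr
      linarith
    have hu' : u.im = -π := by rw [hδ, hδ0, sub_zero]
    have hwim : (Complex.exp u).im = 0 := by rw [hexpim, hδ0, sin_zero, mul_zero]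
    have hkeq : k = -1 := by
      have : (-2 : ℝ) < k := by
        by_contra! hlt
        nlinarith
      have : -2 < k := by exact_mod_cast this
      omega
    have hwre : (Complex.exp u).re = -rexp u.re := by
      rw [hexpre, hu', cos_neg, cos_pi, mul_neg_one]
    have he := exp_neg_one_gt_d9
    rw [hkeq, branchRange, if_neg (by norm_num), if_neg (by norm_num)]
    refine ⟨?_, ?_, fun _ => ?_, fun hc => ?_⟩
    · rw [hwim]; push_cast; linarith
    · rw [hwim]; push_cast; linarith
    · rw [curveFun, hwim, hwre, sinc_zero, cos_zero]
      linarith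
    · rw [hwim] at hc
      push_cast at hc
      linarith
  -- Here `|z| > 1` puts `L₁` in the right half-plane, so `|Im u| < π/2 + 1 < π`.
  · have hre : 0 < (L₁ k z).re := by
      rw [L₁_re]
      exact log_pos (hk h0)
    have := abs_lt.mp (Complex.abs_arg_lt_pi_div_two_iff.mpr (Or.inl hre))
    exact hmem (abs_lt.mpr ⟨by linarith, by linarith⟩)
  · have hk1 : (1 : ℝ) ≤ k := by exact_mod_cast h0
    -- The inequality is strict because the argument of `z` is never `-π`, so an overshoot `δ = 0`
    -- is excluded as well.
    have hLpos : π < (L₁ k z).im := by nlinarith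
    have harg : 0 ≤ (L₁ k z).arg := Complex.arg_nonneg_iff.mpr (by linarith)
    rcases lt_or_ge u.im π with hu | hu
    · exact hmem (abs_lt.mpr ⟨by linarith, hu⟩)
    obtain ⟨δ, hδ⟩ : ∃ δ, u.im = δ + π := ⟨u.im - π, by ring⟩
    rw [hδ, sin_add_pi] at hexpim
    rcases (show 0 ≤ δ by linarith).eq_or_lt with hδ0 | hδ0
    · rw [← hδ0, sin_zero, neg_zero, mul_zero] at hexpim
      linarith
    · have := self_lt_mul_sin hδ0 (by linarith) hr
      linarith

/-- The Lambert function in terms of the double series. -/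
theorem W_eq_series {k : ℤ} {z : ℂ} (hz : z ≠ 0) (hk : k = 0 → 1 < ‖z‖)
    (hσ : ‖sigma k z‖ < 1 / 4) (hτ : ‖tau k z‖ < 1 / 4) :
    W k z = L₁ k z - L₂ k z + series (sigma k z) (tau k z) := by
  have hne := L₁_ne_zero hk
  have hL : 4 < ‖L₁ k z‖ := by
    rw [sigma, norm_div, norm_one] at hσ
    exact (one_div_lt_one_div (norm_pos_iff.mpr hne) (by norm_num)).mp hσ
  have hexp := exp_neg_series hσ hτ
  have hv := norm_series_lt_one hσ hτ
  set v := series (sigma k z) (tau k z)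
  have hw : Complex.exp (L₂ k z - v) = L₁ k z - L₂ k z + v := by
    rw [sub_eq_add_neg, Complex.exp_add, hexp, L₂, Complex.exp_log hne, sigma, tau, L₂]
    field_simp
  have hmem := exp_L₂_sub_mem_branchRange hk hL hv (by rw [hw]; ring)
  rw [hw] at hmem
  refine W_eq hz hmem ?_
  nth_rw 1 [← hw]
  rw [← Complex.exp_add, show L₂ k z - v + (L₁ k z - L₂ k z + v) = L₁ k z by ring, exp_L₁ k hz]

end Expansion

end LambertW

theorem mainTheorem2 (k : ℤ) (z : ℂ) (hz : z ≠ 0) (hk : k = 0 → 1 < ‖z‖)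
    (hσ : ‖LambertW.sigma k z‖ < 1 / 4) (hτ : ‖LambertW.tau k z‖ < 1 / 4) (L M : ℕ) :
    ∃ ε : ℂ,
      LambertW.W k z = LambertW.L₁ k z - LambertW.L₂ k z
        + ∑ l ∈ Finset.range L, ∑ m ∈ Finset.Ico 1 M,
            (LambertW.c l m : ℂ) * LambertW.sigma k z ^ l * LambertW.tau k z ^ m
        + ε ∧
      ‖ε‖ ≤ (4 * ‖LambertW.tau k z‖ * (4 * ‖LambertW.sigma k z‖) ^ L
              + (4 * ‖LambertW.tau k z‖) ^ M)
            / ((1 - 4 * ‖LambertW.sigma k z‖) * (1 - 4 * ‖LambertW.tau k z‖)) := by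
  refine ⟨LambertW.series (LambertW.sigma k z) (LambertW.tau k z)
    - ∑ l ∈ Finset.range L, ∑ m ∈ Finset.Ico 1 M,
        (LambertW.c l m : ℂ) * LambertW.sigma k z ^ l * LambertW.tau k z ^ m, ?_,
    LambertW.norm_series_sub_sum_le hσ hτ L M⟩
  rw [LambertW.W_eq_series hz hk hσ hτ]
  ring
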